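/- Let $V$ be a compact complex manifold of dimension $n$ without boundary with a Kähler metric $g_V$, and let $R$ be a compact Riemann surface with non-empty boundary with a Kähler (i.e. conformal Hermitian) metric $g_R$, for instance $|dw|^2$ on a cylinder. Let $g=(g_{\alpha\bar\beta})_{1\le\alpha,\beta\le n+1}$ be the product metric on $V\times R$, and note $\partial(V\times R)=V\times\partial R$. A function $\psi$ on $V\times R$ is called generalized plurisubharmonic if it is continuous on $V\times R$, of class $C^2$ in the interior, and the Hermitian matrix $\big(g_{\alpha\bar\beta}+\frac{\partial^2\psi}{\partial z_\alpha\partial\bar z_\beta}\big)_{1\le\alpha,\beta\le n+1}$ is positive definite there. Let $h:\partial(V\times R)\to\mathbb R$. A continuous function $\varphi:V\times R\to\mathbb R$ is called a weak $C^0$ solution of the degenerate Monge–Ampère equation $$\det\Big(g_{\alpha\bar\beta}+\frac{\partial^2\varphi}{\partial z_\alpha\partial\bar z_\beta}\Big)_{(n+1)\times(n+1)}=0\ \text{ in } V\times R$$ with boundary data $h$ if for every $\varepsilon>0$ there are a generalized plurisubharmonic function $\psi$ on $V\times R$ and a function $f$ with $0<f<\varepsilon$ such that $|\varphi-\psi|<\varepsilon$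 on $V\times R$, $\det\big(g_{\alpha\bar\beta}+\frac{\partial^2\psi}{\partial z_\alpha\partial\bar z_\beta}\big)=f\det(g_{\alpha\bar\beta})$ in the interior of $V\times R$, and $\psi=h$ on $\partial(V\times R)$. **Theorem.** If $\varphi_1,\varphi_2$ are weak $C^0$ solutions of the degenerate Monge–Ampère equation with boundary data $h_1,h_2$ respectively, then the following maxima exist and $$\max_{V\times R}|\varphi_1-\varphi_2|\le\max_{\partial(V\times R)}|h_1-h_2|.$$ **Corollary.** Two weak $C^0$ solutions of the degenerate Monge–Ampère equation with the same boundary data coincide. -/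

import Mathlib

open Set
open scoped Manifold ContDiff ComplexConjugate ComplexOrder

noncomputable section

/-! ### Complex manifolds with boundary of complex dimension one -/

/-- The closed upper half plane, on which Riemann surfaces with boundary are modelled. -/
abbrev ClosedHalfPlane : Type := {z : ℂ // 0 ≤ z.im}

theorem range_val_closedHalfPlane :
    range (Subtype.val : ClosedHalfPlane → ℂ) = {z : ℂ | 0 ≤ z.im} :=
  Subtype.range_coe

/-- The closed upper half plane as a model with corners over `ℂ`. A space which is an
`IsManifold halfPlaneModel ∞` is a Riemann surface with (possibly empty) boundary: the transition
maps are holomorphic, and smooth up to the boundary. -/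
def halfPlaneModel : ModelWithCorners ℂ ℂ ClosedHalfPlane where
  toFun := Subtype.val
  invFun z := ⟨⟨z.re, max z.im 0⟩, le_max_right _ _⟩
  source := univ
  target := {z | 0 ≤ z.im}
  map_source' z _ := z.property
  map_target' _ _ := mem_univ _
  left_inv' := fun ⟨z, hz⟩ _ => Subtype.ext (Complex.ext rfl (max_eq_left hz))
  right_inv' _ hz := Complex.ext rfl (max_eq_left hz)
  source_eq := rfl
  convex_range' := by
    simp only [instIsRCLikeNormedField, ↓reduceDIte]
    apply Convex.convex_isRCLikeNormedField
    rw [range_val_closedHalfPlane]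
    exact convex_halfSpace_im_ge 0
  nonempty_interior' := by
    rw [range_val_closedHalfPlane, Complex.interior_setOfPred_le_im]
    exact ⟨Complex.I, by simp⟩
  continuous_toFun := continuous_subtype_val
  continuous_invFun := by
    refine Continuous.subtype_mk ?_ _
    have h : Continuous fun z : ℂ => ((z.re : ℂ) + (max z.im 0 : ℝ) * Complex.I) := by fun_prop
    exact h.congr fun z => by simp [Complex.ext_iff]

section Wirtinger

variable {E : Type*} [NormedAddCommGroup E] [NormedSpace ℂ E]

/-- The Wirtinger derivative `∂F` at `y`, applied to `v`: for `E = ℂᵐ` and `v = e_α` this is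
`∂F/∂z_α = (∂F/∂x_α - i ∂F/∂y_α) / 2`. -/
def dZ (F : E → ℂ) (y v : E) : ℂ :=
  (fderiv ℝ F y v - Complex.I * fderiv ℝ F y (Complex.I • v)) / 2

/-- The Wirtinger derivative `∂̄F` at `y`, applied to `v`: for `E = ℂᵐ` and `v = e_α` this is
`∂F/∂z̄_α = (∂F/∂x_α + i ∂F/∂y_α) / 2`. -/
def dZbar (F : E → ℂ) (y v : E) : ℂ :=
  (fderiv ℝ F y v + Complex.I * fderiv ℝ F y (Complex.I • v)) / 2

/-- The complex Hessian of a real function: for `E = ℂᵐ`, `v = e_α`, `w = e_β` this is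
`∂²u/∂z_α ∂z̄_β`. -/
def complexHessian (u : E → ℝ) (y v w : E) : ℂ :=
  dZ (fun y' => dZbar (fun y'' => (u y'' : ℂ)) y' w) y v

end Wirtinger

section Metric

variable {E : Type*} [NormedAddCommGroup E] [NormedSpace ℂ E]
  {H : Type*} [TopologicalSpace H] (I : ModelWithCorners ℂ E H)
  (M : Type*) [TopologicalSpace M] [ChartedSpace H M]

variable {M} in
/-- The coefficient `g(v, w̄)` of a family of sesquilinear forms on the (holomorphic) tangent
spaces, read in the chart around `c`, as a function of the coordinate `y`. -/
def metricCoeff (g : ∀ x : M, TangentSpace I x →L[ℂ] TangentSpace I x →L⋆[ℂ] ℂ)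
    (c : M) (v w y : E) : ℂ :=
  g ((extChartAt I c).symm y)
    (mfderivWithin 𝓘(ℂ, E) I (extChartAt I c).symm (range I) y v)
    (mfderivWithin 𝓘(ℂ, E) I (extChartAt I c).symm (range I) y w)

/-- A Kähler metric `∑ g_{αβ̄} dz_α dz̄_β`: a smooth positive definite Hermitian form on the tangent
spaces whose Kähler form is closed, i.e. `∂g_{αβ̄}/∂z_γ = ∂g_{γβ̄}/∂z_α` in the charts. (At boundary
points closedness follows from the interior by continuity.) -/
structure KahlerMetric where
  /-- The Hermitian form, linear in the first and conjugate linear in the second variable. -/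
  form : ∀ x : M, TangentSpace I x →L[ℂ] TangentSpace I x →L⋆[ℂ] ℂ
  conj_symm : ∀ (x : M) (v w : TangentSpace I x), conj (form x v w) = form x w v
  pos : ∀ (x : M) (v : TangentSpace I x), v ≠ 0 → 0 < (form x v v).re
  smooth : ∀ (c : M) (v w : E),
    ContDiffOn ℝ ∞ (metricCoeff I form c v w) (extChartAt I c).target
  closed : ∀ (c : M) (u v w : E), ∀ y ∈ interior (extChartAt I c).target,
    dZ (metricCoeff I form c v w) y u = dZ (metricCoeff I form c u w) y v

end Metric

section Product

/-- The model of the product of an `n`-dimensional complex manifold (without boundary) and a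
Riemann surface with boundary. -/
abbrev productModel (n : ℕ) :
    ModelWithCorners ℂ (EuclideanSpace ℂ (Fin n) × ℂ)
      (ModelProd (EuclideanSpace ℂ (Fin n)) ClosedHalfPlane) :=
  𝓘(ℂ, EuclideanSpace ℂ (Fin n)).prod halfPlaneModel

/-- The coordinate vectors `e_1, …, e_n, e_{n+1}` of `ℂⁿ × ℂ`; the last one is `Sum.inr ()`. -/
def coordVec (n : ℕ) : Fin n ⊕ Unit → EuclideanSpace ℂ (Fin n) × ℂ
  | Sum.inl i => (EuclideanSpace.single i 1, 0)
  | Sum.inr _ => (0, 1)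

variable {n : ℕ}
  {V : Type*} [TopologicalSpace V] [ChartedSpace (EuclideanSpace ℂ (Fin n)) V]
  {R : Type*} [TopologicalSpace R] [ChartedSpace ClosedHalfPlane R]
  (gV : KahlerMetric 𝓘(ℂ, EuclideanSpace ℂ (Fin n)) V) (gR : KahlerMetric halfPlaneModel R)

/-- The matrix `(g_{αβ̄})` of size `n + 1` of the product metric at `p`, in the coordinates given by
the preferred chart at `p` (the tangent space at `p` is `ℂⁿ × ℂ` through that chart). -/
def metricMatrix (p : V × R) : Matrix (Fin n ⊕ Unit) (Fin n ⊕ Unit) ℂ :=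
  Matrix.of fun a b =>
    gV.form p.1 (coordVec n a).1 (coordVec n b).1 + gR.form p.2 (coordVec n a).2 (coordVec n b).2

/-- The matrix `(∂²φ/∂z_α ∂z̄_β)` of size `n + 1` at `p`, in the coordinates given by the preferred
chart at `p`. -/
def hessianMatrix (φ : V × R → ℝ) (p : V × R) : Matrix (Fin n ⊕ Unit) (Fin n ⊕ Unit) ℂ :=
  Matrix.of fun a b =>
    complexHessian (φ ∘ (extChartAt (productModel n) p).symm) (extChartAt (productModel n) p p)
      (coordVec n a) (coordVec n b)

/-- Generalized plurisubharmonic functions: continuous on `V × R`, of class `C²` in its interior,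
with `(g_{αβ̄} + ∂²φ/∂z_α ∂z̄_β)` Hermitian and strictly positive there. -/
structure IsGeneralizedPSH (φ : V × R → ℝ) : Prop where
  continuous : Continuous φ
  contDiffAt : ∀ p ∈ (productModel n).interior (V × R),
    ContDiffAt ℝ 2 (φ ∘ (extChartAt (productModel n) p).symm) (extChartAt (productModel n) p p)
  posDef : ∀ p ∈ (productModel n).interior (V × R),
    (metricMatrix gV gR p + hessianMatrix φ p).PosDef

/-- `φ` solves the Dirichlet problem `det (g_{αβ̄} + ∂²φ/∂z_α ∂z̄_β) = f det (g_{αβ̄})` in `V × R`,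
`φ = h` on `∂(V × R)`. -/
def SolvesMongeAmpere (f : V × R → ℝ) (h : (productModel n).boundary (V × R) → ℝ)
    (φ : V × R → ℝ) : Prop :=
  (∀ p ∈ (productModel n).interior (V × R),
    (metricMatrix gV gR p + hessianMatrix φ p).det = (f p : ℂ) * (metricMatrix gV gR p).det) ∧
  ∀ q : (productModel n).boundary (V × R), φ q = h q

/-- Weak `C⁰` solutions, with boundary data `h`, of the degenerate Monge-Ampère equation
`det (g_{αβ̄} + ∂²φ/∂z_α ∂z̄_β) = 0`. -/
def IsWeakC0Solution (h : (productModel n).boundary (V × R) → ℝ) (φ : V × R → ℝ) : Prop :=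
  Continuous φ ∧
  ∀ ε : ℝ, 0 < ε → ∃ (ψ f : V × R → ℝ),
    IsGeneralizedPSH gV gR ψ ∧
    (∀ p, |φ p - ψ p| < ε) ∧
    (∀ p ∈ (productModel n).interior (V × R), 0 < f p ∧ f p < ε) ∧
    SolvesMongeAmpere gV gR f h ψ

end Product

end

noncomputable section

section Determinant

variable {ι : Type*} [Fintype ι] [DecidableEq ι]

open Matrix
open scoped MatrixOrder

theorem Matrix.PosSemidef.one_le_det_one_add {T : Matrix ι ι ℂ} (hT : T.PosSemidef) :
    1 ≤ (1 + T).det := by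
  have h1 : (1 + T).det = ∏ i, (1 + (hT.1.eigenvalues i : ℂ)) := by
    have h := congrArg (Polynomial.eval (-1)) hT.1.charpoly_eq
    rw [Matrix.eval_charpoly, Polynomial.eval_prod] at h
    have h2 : scalar ι (-1 : ℂ) - T = -(1 + T) := by
      rw [map_neg, map_one]; abel
    have h3 : ∀ i, Polynomial.eval (-1 : ℂ) (Polynomial.X - Polynomial.C
        ((hT.1.eigenvalues i : ℝ) : ℂ)) = -1 * (1 + (hT.1.eigenvalues i : ℂ)) := by
      intro i; simp; ring
    rw [h2, det_neg] at h
    erw [Finset.prod_congr rfl fun i _ => h3 i] at h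
    rw [Finset.prod_mul_distrib, Finset.prod_const, Finset.card_univ] at h
    exact mul_left_cancel₀ (pow_ne_zero _ (by norm_num)) h
  rw [h1]
  have h4 : (1 : ℝ) ≤ ∏ i, (1 + hT.1.eigenvalues i) :=
    Finset.prod_induction _ (fun r : ℝ => 1 ≤ r) (fun _ _ => one_le_mul_of_one_le_of_one_le) le_rfl
      fun i _ => by linarith [hT.eigenvalues_nonneg i]
  exact_mod_cast h4

/-- The determinant is monotone on positive definite Hermitian matrices. -/
theorem Matrix.PosDef.det_le_det_add {P S : Matrix ι ι ℂ} (hP : P.PosDef) (hS : S.PosSemidef) :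
    P.det ≤ (P + S).det := by
  obtain ⟨B, hB, rfl⟩ : ∃ B : Matrix ι ι ℂ, IsUnit B.det ∧ P = Bᴴ * B := by
    obtain ⟨B, hB⟩ := (CStarAlgebra.nonneg_iff_eq_star_mul_self (a := P)).1
      (Matrix.nonneg_iff_posSemidef.2 hP.posSemidef)
    refine ⟨B, ?_, hB⟩
    have h := hP.det_pos.ne'
    rw [hB, det_mul] at h
    exact isUnit_iff_ne_zero.2 (right_ne_zero_of_mul h)
  have hT : (B⁻¹ᴴ * S * B⁻¹).PosSemidef := hS.conjTranspose_mul_mul_same _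
  have h1 : B⁻¹ * B = 1 := nonsing_inv_mul B hB
  have h2 : Bᴴ * B⁻¹ᴴ = 1 := by rw [← conjTranspose_mul, h1, conjTranspose_one]
  have h3 : Bᴴ * B + S = Bᴴ * (1 + B⁻¹ᴴ * S * B⁻¹) * B := by
    have h : Bᴴ * (B⁻¹ᴴ * S * B⁻¹) * B = (Bᴴ * B⁻¹ᴴ) * S * (B⁻¹ * B) := by
      simp only [Matrix.mul_assoc]
    rw [Matrix.mul_add, Matrix.add_mul, h, h1, h2, Matrix.mul_one, Matrix.mul_one, Matrix.one_mul]
  have h4 : (Bᴴ * B + S).det = (Bᴴ * B).det * (1 + B⁻¹ᴴ * S * B⁻¹).det := by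
    rw [h3]; simp only [det_mul]; ring
  rw [h4]
  exact le_mul_of_one_le_right hP.det_pos.le hT.one_le_det_one_add

end Determinant

section Sesquilinear

variable {ι E : Type*} [Fintype ι] [AddCommGroup E] [Module ℂ E]

open Matrix

theorem star_dotProduct_mulVec_sesquilinear (Q : E →ₗ[ℂ] E →ₗ⋆[ℂ] ℂ) (e : ι → E) (x : ι → ℂ) :
    star x ⬝ᵥ ((Matrix.of fun a b => Q (e a) (e b)) *ᵥ x) =
      Q (∑ a, conj (x a) • e a) (∑ a, conj (x a) • e a) := by
  simp only [map_sum, LinearMap.sum_apply, map_smul, LinearMap.smul_apply, map_smulₛₗ,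
    dotProduct, mulVec, Pi.star_apply, of_apply, smul_eq_mul, Complex.conj_conj, Finset.mul_sum,
    RCLike.star_def]
  rw [Finset.sum_comm]
  refine Finset.sum_congr rfl fun a _ => Finset.sum_congr rfl fun b _ => by ring

end Sesquilinear

section Hessian

variable {E : Type*} [NormedAddCommGroup E] [NormedSpace ℂ E]

/-- At an interior local maximum the second derivative is negative semidefinite. -/
theorem IsLocalMax.fderiv_fderiv_apply_nonpos {F : Type*} [NormedAddCommGroup F] [NormedSpace ℝ F]
    {u : F → ℝ} {y : F} (hmax : IsLocalMax u y)
    (hu : ContDiffAt ℝ 2 u y) (v : F) : fderiv ℝ (fderiv ℝ u) y v v ≤ 0 := by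
  have hline : ∀ t : ℝ, HasDerivAt (fun t : ℝ => y + t • v) v t := fun t => by
    simpa using ((hasDerivAt_id t).smul_const v).const_add y
  have hlim : Filter.Tendsto (fun t : ℝ => y + t • v) (nhds 0) (nhds y) := by
    simpa using (hline 0).continuousAt.tendsto
  have hd : ∀ᶠ z in nhds y, DifferentiableAt ℝ u z :=
    (hu.eventually (by simp)).mono fun z hz => hz.differentiableAt (by norm_num)
  have hderiv : deriv (fun t : ℝ => u (y + t • v)) =ᶠ[nhds 0]
      fun t => fderiv ℝ u (y + t • v) v := by
    filter_upwards [hlim.eventually hd] with t ht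
    exact (ht.hasFDerivAt.comp_hasDerivAt t (hline t)).deriv
  have hD : DifferentiableAt ℝ (fderiv ℝ u) y :=
    (hu.fderiv_right (m := 1) (by norm_num)).differentiableAt (by norm_num)
  have hdd : deriv (deriv fun t : ℝ => u (y + t • v)) 0 = fderiv ℝ (fderiv ℝ u) y v v := by
    rw [hderiv.deriv_eq]
    have hD0 : HasFDerivAt (fderiv ℝ u) (fderiv ℝ (fderiv ℝ u) y) (y + (0 : ℝ) • v) := by
      simpa using hD.hasFDerivAt
    have h := (ContinuousLinearMap.apply ℝ ℝ v).hasFDerivAt.comp_hasDerivAt (0 : ℝ)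
      (hD0.comp_hasDerivAt (0 : ℝ) (hline 0))
    exact h.deriv
  have hmax0 : IsLocalMax (fun t : ℝ => u (y + t • v)) 0 := by
    filter_upwards [hlim.eventually hmax] with t ht
    simpa using ht
  by_contra! hpos
  rw [← hdd] at hpos
  have hcont : ContinuousAt (fun t : ℝ => u (y + t • v)) 0 := by
    refine ContinuousAt.comp ?_ (hline 0).continuousAt
    simpa using hu.continuousAt
  have hmin := isLocalMin_of_deriv_deriv_pos hpos hmax0.deriv_eq_zero hcont
  have hconst : (fun t : ℝ => u (y + t • v)) =ᶠ[nhds 0] fun _ => u (y + (0 : ℝ) • v) := by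
    filter_upwards [hmin, hmax0] with t h1 h2 using le_antisymm h2 h1
  have h := hconst.deriv.deriv_eq
  simp only [deriv_const', deriv_const] at h
  exact hpos.ne' h

/-- The complex Hessian in terms of the second real derivative. -/
theorem complexHessian_eq {u : E → ℝ} {y : E} (hu : ContDiffAt ℝ 2 u y) (v w : E) :
    complexHessian u y v w =
      ((fderiv ℝ (fderiv ℝ u) y v w + fderiv ℝ (fderiv ℝ u) y (Complex.I • v) (Complex.I • w) : ℝ)
        + Complex.I * (fderiv ℝ (fderiv ℝ u) y v (Complex.I • w)
          - fderiv ℝ (fderiv ℝ u) y (Complex.I • v) w : ℝ)) / 4 := by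
  have hd : ∀ᶠ z in nhds y, DifferentiableAt ℝ u z :=
    (hu.eventually (by simp)).mono fun z hz => hz.differentiableAt (by norm_num)
  have hD : HasFDerivAt (fderiv ℝ u) (fderiv ℝ (fderiv ℝ u) y) y :=
    ((hu.fderiv_right (m := 1) (by norm_num)).differentiableAt (by norm_num)).hasFDerivAt
  have hbar : (fun y' => dZbar (fun y'' => (u y'' : ℂ)) y' w) =ᶠ[nhds y] fun y' =>
      ((fderiv ℝ u y' w : ℂ) + Complex.I * (fderiv ℝ u y' (Complex.I • w) : ℝ)) * (1 / 2) := by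
    filter_upwards [hd] with z hz
    have h : HasFDerivAt (fun y'' => (u y'' : ℂ)) (Complex.ofRealCLM.comp (fderiv ℝ u z)) z :=
      Complex.ofRealCLM.hasFDerivAt.comp z hz.hasFDerivAt
    rw [dZbar, h.fderiv]
    simp only [ContinuousLinearMap.comp_apply, Complex.ofRealCLM_apply]
    ring
  have hev : ∀ a : E, HasFDerivAt (fun y' => ((fderiv ℝ u y' a : ℝ) : ℂ))
      (Complex.ofRealCLM.comp ((fderiv ℝ (fderiv ℝ u) y).flip a)) y := fun a => by
    refine Complex.ofRealCLM.hasFDerivAt.comp y ?_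
    simpa using hD.clm_apply (hasFDerivAt_const a y)
  have h := (((hev w).add ((hev (Complex.I • w)).const_mul Complex.I)).mul_const (1 / 2 : ℂ))
  have hH : fderiv ℝ (fun y' => dZbar (fun y'' => (u y'' : ℂ)) y' w) y = _ :=
    hbar.fderiv_eq.trans h.fderiv
  rw [complexHessian, dZ, hH]
  simp
  ring_nf
  simp
  ring

theorem complexHessian_const_mul_sub {u₁ u₂ : E → ℝ} {y : E} (hu₁ : ContDiffAt ℝ 2 u₁ y)
    (hu₂ : ContDiffAt ℝ 2 u₂ y) (c : ℝ) (v w : E) :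
    complexHessian (fun z => c * u₁ z - u₂ z) y v w =
      c * complexHessian u₁ y v w - complexHessian u₂ y v w := by
  have hu : ContDiffAt ℝ 2 (fun z => c * u₁ z - u₂ z) y := (contDiffAt_const.mul hu₁).sub hu₂
  have hd : ∀ {u : E → ℝ}, ContDiffAt ℝ 2 u y → ∀ᶠ z in nhds y, DifferentiableAt ℝ u z :=
    fun hu => (hu.eventually (by simp)).mono fun z hz => hz.differentiableAt (by norm_num)
  have hD : ∀ {u : E → ℝ}, ContDiffAt ℝ 2 u y → DifferentiableAt ℝ (fderiv ℝ u) y :=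
    fun hu => (hu.fderiv_right (m := 1) (by norm_num)).differentiableAt (by norm_num)
  have h1 : fderiv ℝ (fun z => c * u₁ z - u₂ z) =ᶠ[nhds y]
      fun z => c • fderiv ℝ u₁ z - fderiv ℝ u₂ z := by
    filter_upwards [hd hu₁, hd hu₂] with z hz₁ hz₂
    exact ((hz₁.hasFDerivAt.const_mul c).sub hz₂.hasFDerivAt).fderiv
  have h2 : fderiv ℝ (fderiv ℝ fun z => c * u₁ z - u₂ z) y =
      c • fderiv ℝ (fderiv ℝ u₁) y - fderiv ℝ (fderiv ℝ u₂) y :=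
    h1.fderiv_eq.trans (((hD hu₁).hasFDerivAt.const_smul c).sub (hD hu₂).hasFDerivAt).fderiv
  rw [complexHessian_eq hu, complexHessian_eq hu₁, complexHessian_eq hu₂, h2]
  simp
  ring

/-- The complex Hessian at a point where the function is `C²`, as a sesquilinear form. -/
def complexHessianForm {u : E → ℝ} {y : E} (hu : ContDiffAt ℝ 2 u y) : E →ₗ[ℂ] E →ₗ⋆[ℂ] ℂ :=
  have hsmul : ∀ (c : ℂ) (v : E), c • v = c.re • v + c.im • (Complex.I • v) := fun c v => by
    conv_lhs => rw [← Complex.re_add_im c, add_smul, mul_smul]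
    simp only [Complex.coe_smul]
  have hI : ∀ v : E, Complex.I • Complex.I • v = -v := fun v => by
    rw [smul_smul, Complex.I_mul_I, neg_one_smul]
  have hIr : ∀ (r : ℝ) (v : E), Complex.I • (r • v) = r • (Complex.I • v) :=
    fun r v => smul_comm _ _ _
  LinearMap.mk₂'ₛₗ (RingHom.id ℂ) (starRingEnd ℂ) (complexHessian u y)
    (fun v v' w => by
      simp only [complexHessian_eq hu, smul_add, map_add, add_apply]
      push_cast; ring)
    (fun c v w => by
      rw [complexHessian_eq hu, complexHessian_eq hu, hsmul c v]
      simp only [smul_add, map_add, map_smul, add_apply,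
        smul_apply, hIr, hI, map_neg, neg_apply]
      apply Complex.ext <;> simp <;> ring)
    (fun v w w' => by
      simp only [complexHessian_eq hu, smul_add, map_add]
      push_cast; ring)
    (fun c v w => by
      rw [complexHessian_eq hu, complexHessian_eq hu, hsmul c w]
      simp only [smul_add, map_add, map_smul, hIr, hI, map_neg]
      apply Complex.ext <;> simp <;> ring)

theorem conj_complexHessian {u : E → ℝ} {y : E} (hu : ContDiffAt ℝ 2 u y) (v w : E) :
    conj (complexHessian u y v w) = complexHessian u y w v := by
  have hsymm : ∀ a b, fderiv ℝ (fderiv ℝ u) y a b = fderiv ℝ (fderiv ℝ u) y b a :=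
    fun a b => (hu.isSymmSndFDerivAt (by simp)).eq a b
  rw [complexHessian_eq hu, complexHessian_eq hu, hsymm w v, hsymm (Complex.I • w) (Complex.I • v),
    hsymm w (Complex.I • v), hsymm (Complex.I • w) v, map_div₀, map_add, map_mul,
    Complex.conj_ofReal, Complex.conj_ofReal, Complex.conj_I, map_ofNat]
  push_cast
  ring

/-- At a local maximum, the matrix of the complex Hessian is negative semidefinite. -/
theorem IsLocalMax.posSemidef_neg_complexHessian {ι : Type*} [Fintype ι] {u : E → ℝ} {y : E}
    (hmax : IsLocalMax u y) (hu : ContDiffAt ℝ 2 u y) (e : ι → E) :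
    (-Matrix.of fun a b => complexHessian u y (e a) (e b)).PosSemidef := by
  refine Matrix.PosSemidef.of_dotProduct_mulVec_nonneg ?_ fun x => ?_
  · refine Matrix.IsHermitian.neg (Matrix.IsHermitian.ext fun a b => ?_)
    exact conj_complexHessian hu _ _
  · have h := star_dotProduct_mulVec_sesquilinear (complexHessianForm hu) e x
    rw [Matrix.neg_mulVec, dotProduct_neg]
    change 0 ≤ -(star x ⬝ᵥ (Matrix.of fun a b => complexHessianForm hu (e a) (e b)).mulVec x)
    rw [h]
    set v := ∑ a, conj (x a) • e a
    change 0 ≤ -complexHessian u y v v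
    have hsymm := (hu.isSymmSndFDerivAt (by simp)).eq v (Complex.I • v)
    rw [complexHessian_eq hu, hsymm, sub_self, Complex.ofReal_zero, mul_zero, add_zero]
    have h1 := hmax.fderiv_fderiv_apply_nonpos hu v
    have h2 := hmax.fderiv_fderiv_apply_nonpos hu (Complex.I • v)
    have h3 : 0 ≤ -((fderiv ℝ (fderiv ℝ u) y v v
        + fderiv ℝ (fderiv ℝ u) y (Complex.I • v) (Complex.I • v)) / 4) := by linarith
    exact_mod_cast h3

end Hessian

section Comparison

variable {n : ℕ}
  {V : Type*} [TopologicalSpace V] [ChartedSpace (EuclideanSpace ℂ (Fin n)) V]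
  {R : Type*} [TopologicalSpace R] [ChartedSpace ClosedHalfPlane R]
  {gV : KahlerMetric 𝓘(ℂ, EuclideanSpace ℂ (Fin n)) V} {gR : KahlerMetric halfPlaneModel R}

theorem sum_smul_coordVec (x : Fin n ⊕ Unit → ℂ) :
    ∑ a, x a • coordVec n a = (WithLp.toLp 2 fun i => x (Sum.inl i), x (Sum.inr ())) := by
  rw [Fintype.sum_sum_type]
  refine Prod.ext ?_ ?_
  · ext j
    simp [coordVec, Prod.fst_sum, Pi.single_apply]
  · simp [coordVec, Prod.snd_sum]

/-- The product metric on the tangent space of `V × R` at `p`, as a sesquilinear form. -/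
def productForm (gV : KahlerMetric 𝓘(ℂ, EuclideanSpace ℂ (Fin n)) V)
    (gR : KahlerMetric halfPlaneModel R) (p : V × R) :
    (EuclideanSpace ℂ (Fin n) × ℂ) →ₗ[ℂ] (EuclideanSpace ℂ (Fin n) × ℂ) →ₗ⋆[ℂ] ℂ :=
  LinearMap.mk₂'ₛₗ (RingHom.id ℂ) (starRingEnd ℂ)
    (fun v w => gV.form p.1 v.1 w.1 + gR.form p.2 v.2 w.2)
    (fun v v' w => by
      have h1 := DFunLike.congr_fun ((gV.form p.1).map_add v.1 v'.1) w.1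
      have h2 := DFunLike.congr_fun ((gR.form p.2).map_add v.2 v'.2) w.2
      exact (congrArg₂ (· + ·) h1 h2).trans (add_add_add_comm _ _ _ _))
    (fun c v w => by
      have h1 := DFunLike.congr_fun ((gV.form p.1).map_smul c v.1) w.1
      have h2 := DFunLike.congr_fun ((gR.form p.2).map_smul c v.2) w.2
      exact (congrArg₂ (· + ·) h1 h2).trans (mul_add _ _ _).symm)
    (fun v w w' => by
      have h1 := (gV.form p.1 v.1).map_add w.1 w'.1
      have h2 := (gR.form p.2 v.2).map_add w.2 w'.2
      exact (congrArg₂ (· + ·) h1 h2).trans (add_add_add_comm _ _ _ _))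
    (fun c v w => by
      have h1 := (gV.form p.1 v.1).map_smulₛₗ c w.1
      have h2 := (gR.form p.2 v.2).map_smulₛₗ c w.2
      exact (congrArg₂ (· + ·) h1 h2).trans (mul_add _ _ _).symm)

theorem KahlerMetric.form_self_pos {E : Type*} [NormedAddCommGroup E] [NormedSpace ℂ E]
    {H : Type*} [TopologicalSpace H] {I : ModelWithCorners ℂ E H}
    {M : Type*} [TopologicalSpace M] [ChartedSpace H M] (g : KahlerMetric I M) (x : M)
    {v : TangentSpace I x} (hv : v ≠ 0) : 0 < g.form x v v :=
  Complex.pos_iff.2 ⟨g.pos x v hv, (Complex.conj_eq_iff_im.1 (g.conj_symm x v v)).symm⟩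

theorem KahlerMetric.form_self_nonneg {E : Type*} [NormedAddCommGroup E] [NormedSpace ℂ E]
    {H : Type*} [TopologicalSpace H] {I : ModelWithCorners ℂ E H}
    {M : Type*} [TopologicalSpace M] [ChartedSpace H M] (g : KahlerMetric I M) (x : M)
    (v : TangentSpace I x) : 0 ≤ g.form x v v := by
  by_cases hv : v = 0
  · rw [hv, map_zero]
  · exact (g.form_self_pos x hv).le

theorem posDef_metricMatrix (p : V × R) : (metricMatrix gV gR p).PosDef := by
  refine Matrix.PosDef.of_dotProduct_mulVec_pos (Matrix.IsHermitian.ext fun a b => ?_) fun x hx => ?_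
  · exact (map_add (starRingEnd ℂ) _ _).trans
      (congrArg₂ (· + ·) (gV.conj_symm p.1 _ _) (gR.conj_symm p.2 _ _))
  · have h := star_dotProduct_mulVec_sesquilinear (productForm gV gR p) (coordVec n) x
    change 0 < star x ⬝ᵥ (Matrix.of fun a b =>
      productForm gV gR p (coordVec n a) (coordVec n b)).mulVec x
    rw [h]
    set v := ∑ a, conj (x a) • coordVec n a with hv
    have hv0 : v.1 ≠ 0 ∨ v.2 ≠ 0 := by
      by_contra! h0
      refine hx (funext ?_)
      rw [hv, sum_smul_coordVec] at h0
      rintro (i | ⟨⟩)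
      · have := congrArg (fun z : EuclideanSpace ℂ (Fin n) => z i) h0.1
        simpa using this
      · simpa using h0.2
    change 0 < gV.form p.1 v.1 v.1 + gR.form p.2 v.2 v.2
    rcases hv0 with h0 | h0
    · exact add_pos_of_pos_of_nonneg (gV.form_self_pos p.1 h0) (gR.form_self_nonneg p.2 v.2)
    · exact add_pos_of_nonneg_of_pos (gV.form_self_nonneg p.1 v.1) (gR.form_self_pos p.2 h0)

/-- At an interior maximum point of `c ψ₁ - ψ₂`, where `ψ₁`, `ψ₂` are generalized
plurisubharmonic and `0 ≤ c < 1`, the Monge-Ampère measure of `ψ₂` is at least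
`(1 - c) ^ (n + 1) det g`. -/
theorem IsGeneralizedPSH.le_det_of_forall_le {ψ₁ ψ₂ : V × R → ℝ} (h₁ : IsGeneralizedPSH gV gR ψ₁)
    (h₂ : IsGeneralizedPSH gV gR ψ₂) {c : ℝ} (hc0 : 0 ≤ c) (hc1 : c < 1) {p : V × R}
    (hp : p ∈ (productModel n).interior (V × R))
    (hmax : ∀ q, c * ψ₁ q - ψ₂ q ≤ c * ψ₁ p - ψ₂ p) :
    (((1 - c) ^ (n + 1) : ℝ) : ℂ) * (metricMatrix gV gR p).det ≤
      (metricMatrix gV gR p + hessianMatrix ψ₂ p).det := by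
  set χ := extChartAt (productModel n) p
  have hu₁ := h₁.contDiffAt p hp
  have hu₂ := h₂.contDiffAt p hp
  have hu : ContDiffAt ℝ 2 (fun z => c * (ψ₁ ∘ χ.symm) z - (ψ₂ ∘ χ.symm) z) (χ p) :=
    (contDiffAt_const.mul hu₁).sub hu₂
  have hloc : IsLocalMax (fun z => c * (ψ₁ ∘ χ.symm) z - (ψ₂ ∘ χ.symm) z) (χ p) := by
    refine Filter.Eventually.of_forall fun z => ?_
    have hχ : χ.symm (χ p) = p := extChartAt_to_inv p
    simpa only [Function.comp_apply, hχ] using hmax (χ.symm z)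
  have hS := hloc.posSemidef_neg_complexHessian hu (coordVec n)
  have hH : (Matrix.of fun a b => complexHessian
      (fun z => c * (ψ₁ ∘ χ.symm) z - (ψ₂ ∘ χ.symm) z) (χ p) (coordVec n a) (coordVec n b)) =
      (c : ℂ) • hessianMatrix ψ₁ p - hessianMatrix ψ₂ p :=
    Matrix.ext fun a b => complexHessian_const_mul_sub hu₁ hu₂ c _ _
  rw [hH] at hS
  have hc0' : (0 : ℂ) ≤ c := by exact_mod_cast hc0
  have hc1' : (0 : ℂ) < ((1 - c : ℝ) : ℂ) := by exact_mod_cast sub_pos.2 hc1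
  have hP := (posDef_metricMatrix (gV := gV) (gR := gR) p).smul hc1'
  have hsum := ((h₁.posDef p hp).posSemidef.smul hc0').add hS
  have hle := hP.det_le_det_add hsum
  have heq : ((1 - c : ℝ) : ℂ) • metricMatrix gV gR p +
      ((c : ℂ) • (metricMatrix gV gR p + hessianMatrix ψ₁ p) +
        -((c : ℂ) • hessianMatrix ψ₁ p - hessianMatrix ψ₂ p)) =
      metricMatrix gV gR p + hessianMatrix ψ₂ p := by
    push_cast
    module
  rw [heq, Matrix.det_smul, Fintype.card_sum, Fintype.card_fin, Fintype.card_unit] at hle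
  exact_mod_cast hle

theorem SolvesMongeAmpere.mem_boundary_of_forall_le {ψ₁ ψ₂ f : V × R → ℝ}
    {h : (productModel n).boundary (V × R) → ℝ} (h₁ : IsGeneralizedPSH gV gR ψ₁)
    (h₂ : IsGeneralizedPSH gV gR ψ₂) (hs : SolvesMongeAmpere gV gR f h ψ₂)
    {c : ℝ} (hc0 : 0 ≤ c) (hc1 : c < 1)
    (hf : ∀ p ∈ (productModel n).interior (V × R), f p < (1 - c) ^ (n + 1)) {p : V × R}
    (hmax : ∀ q, c * ψ₁ q - ψ₂ q ≤ c * ψ₁ p - ψ₂ p) :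
    p ∈ (productModel n).boundary (V × R) := by
  by_contra hb
  have hp : p ∈ (productModel n).interior (V × R) := by
    rwa [← ModelWithCorners.compl_boundary]
  have hle := h₁.le_det_of_forall_le h₂ hc0 hc1 hp hmax
  rw [hs.1 p hp] at hle
  refine hle.not_gt (mul_lt_mul_of_pos_right ?_ (posDef_metricMatrix p).det_pos)
  exact_mod_cast hf p hp

theorem IsWeakC0Solution.eq_of_mem_boundary {h : (productModel n).boundary (V × R) → ℝ}
    {φ : V × R → ℝ} (hφ : IsWeakC0Solution gV gR h φ) (q : (productModel n).boundary (V × R)) :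
    φ q = h q := by
  rw [← sub_eq_zero, ← abs_nonpos_iff]
  refine le_of_forall_gt_imp_ge_of_dense fun ε hε => ?_
  obtain ⟨ψ, f, -, hlt, -, hs⟩ := hφ.2 ε hε
  rw [← hs.2 q]
  exact (hlt q).le

theorem IsWeakC0Solution.exists_mem_boundary_sub_le [CompactSpace V] [CompactSpace R]
    {h₁ h₂ : (productModel n).boundary (V × R) → ℝ} {φ₁ φ₂ : V × R → ℝ}
    (H₁ : IsWeakC0Solution gV gR h₁ φ₁) (H₂ : IsWeakC0Solution gV gR h₂ φ₂) (p : V × R)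
    {η : ℝ} (hη : 0 < η) :
    ∃ q ∈ (productModel n).boundary (V × R), φ₁ p - φ₂ p ≤ φ₁ q - φ₂ q + η := by
  obtain ⟨K, hK⟩ := isCompact_univ.exists_bound_of_continuousOn H₁.1.continuousOn
  have hK' : ∀ q, |φ₁ q| ≤ K := fun q => hK q (mem_univ q)
  have hK0 : 0 ≤ K := (abs_nonneg _).trans (hK' p)
  obtain ⟨ψ₁, -, P₁, A₁, -, -⟩ := H₁.2 (min (η / 8) 1) (by positivity)
  obtain ⟨δ, hδ0, hδ1, hδ⟩ : ∃ δ : ℝ, 0 < δ ∧ δ ≤ 1 ∧ δ * (K + 1) ≤ η / 4 := by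
    refine ⟨min 1 (η / 4 / (K + 1)), by positivity, min_le_left _ _, ?_⟩
    rw [← le_div_iff₀ (by positivity)]
    exact min_le_right _ _
  obtain ⟨ψ₂, f, P₂, A₂, hf, hs⟩ := H₂.2 (min (η / 8) (δ ^ (n + 1))) (by positivity)
  have : Nonempty (V × R) := ⟨p⟩
  obtain ⟨q, -, hq⟩ := isCompact_univ.exists_isMaxOn univ_nonempty
    ((P₁.continuous.const_mul (1 - δ)).sub P₂.continuous).continuousOn
  have hq' : ∀ x, (1 - δ) * ψ₁ x - ψ₂ x ≤ (1 - δ) * ψ₁ q - ψ₂ q := fun x => hq (mem_univ x)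
  refine ⟨q, hs.mem_boundary_of_forall_le P₁ P₂ (by linarith) (by linarith)
    (fun x hx => ?_) hq', ?_⟩
  · rw [sub_sub_cancel]
    exact (hf x hx).2.trans_le (min_le_right _ _)
  have hψ : ∀ x, |δ * ψ₁ x| ≤ η / 4 := fun x => by
    rw [abs_mul, abs_of_pos hδ0]
    refine (mul_le_mul_of_nonneg_left ?_ hδ0.le).trans hδ
    have h1 := abs_sub_abs_le_abs_sub (ψ₁ x) (φ₁ x)
    rw [abs_sub_comm] at h1
    linarith [hK' x, (A₁ x).trans_le (min_le_right _ _)]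
  have a1 := abs_lt.1 ((A₁ p).trans_le (min_le_left _ _))
  have a2 := abs_lt.1 ((A₂ p).trans_le (min_le_left _ _))
  have a3 := abs_lt.1 ((A₁ q).trans_le (min_le_left _ _))
  have a4 := abs_lt.1 ((A₂ q).trans_le (min_le_left _ _))
  have a5 := abs_le.1 (hψ p)
  have a6 := abs_le.1 (hψ q)
  have a7 := hq' p
  linarith [a1.1, a1.2, a2.1, a2.2, a3.1, a3.2, a4.1, a4.2, a5.1, a5.2, a6.1, a6.2]

theorem isCompact_boundary_product [CompactSpace V] [CompactSpace R]
    [IsManifold halfPlaneModel ∞ R] : IsCompact ((productModel n).boundary (V × R)) := by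
  rw [ModelWithCorners.boundary_of_boundaryless_left]
  exact isCompact_univ.prod
    (ModelWithCorners.isClosed_boundary (I := halfPlaneModel) (M := R) (n := ∞) (by simp)).isCompact

end Comparison

end

theorem theorem4 {n : ℕ}
    {V : Type*} [TopologicalSpace V] [T2Space V] [CompactSpace V] [Nonempty V]
    [ChartedSpace (EuclideanSpace ℂ (Fin n)) V]
    [IsManifold 𝓘(ℂ, EuclideanSpace ℂ (Fin n)) ∞ V]
    {R : Type*} [TopologicalSpace R] [T2Space R] [CompactSpace R]
    [ChartedSpace ClosedHalfPlane R] [IsManifold halfPlaneModel ∞ R]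
    (hR : (halfPlaneModel.boundary R).Nonempty)
    (gV : KahlerMetric 𝓘(ℂ, EuclideanSpace ℂ (Fin n)) V) (gR : KahlerMetric halfPlaneModel R) :
    (∀ (h₁ h₂ : (productModel n).boundary (V × R) → ℝ) (φ₁ φ₂ : V × R → ℝ),
      IsWeakC0Solution gV gR h₁ φ₁ → IsWeakC0Solution gV gR h₂ φ₂ →
      ∃ m m' : ℝ,
        IsGreatest (Set.range fun p : V × R => |φ₁ p - φ₂ p|) m ∧
        IsGreatest (Set.range fun q : (productModel n).boundary (V × R) => |h₁ q - h₂ q|) m' ∧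
        m ≤ m') ∧
    (∀ (h : (productModel n).boundary (V × R) → ℝ) (φ₁ φ₂ : V × R → ℝ),
      IsWeakC0Solution gV gR h φ₁ → IsWeakC0Solution gV gR h φ₂ → φ₁ = φ₂) := by
  have main : ∀ (h₁ h₂ : (productModel n).boundary (V × R) → ℝ) (φ₁ φ₂ : V × R → ℝ),
      IsWeakC0Solution gV gR h₁ φ₁ → IsWeakC0Solution gV gR h₂ φ₂ →
      ∃ m m' : ℝ,
        IsGreatest (Set.range fun p : V × R => |φ₁ p - φ₂ p|) m ∧
        IsGreatest (Set.range fun q : (productModel n).boundary (V × R) => |h₁ q - h₂ q|) m' ∧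
        m ≤ m' := by
    intro h₁ h₂ φ₁ φ₂ H₁ H₂
    obtain ⟨r, hr⟩ := hR
    have hne : Nonempty (V × R) := ⟨(Classical.arbitrary V, r)⟩
    have hbne : ((productModel n).boundary (V × R)).Nonempty := by
      refine ⟨(Classical.arbitrary V, r), ?_⟩
      rw [ModelWithCorners.boundary_of_boundaryless_left]
      exact ⟨mem_univ _, hr⟩
    have hcont : Continuous fun p => |φ₁ p - φ₂ p| := (H₁.1.sub H₂.1).abs
    obtain ⟨p, -, hp⟩ := isCompact_univ.exists_isMaxOn univ_nonempty hcont.continuousOn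
    obtain ⟨q, hqb, hq⟩ := isCompact_boundary_product.exists_isMaxOn hbne hcont.continuousOn
    have heq : ∀ x : (productModel n).boundary (V × R), |h₁ x - h₂ x| = |φ₁ x - φ₂ x| :=
      fun x => by rw [H₁.eq_of_mem_boundary x, H₂.eq_of_mem_boundary x]
    refine ⟨|φ₁ p - φ₂ p|, |φ₁ q - φ₂ q|, ⟨⟨p, rfl⟩, ?_⟩, ⟨⟨⟨q, hqb⟩, heq _⟩, ?_⟩, ?_⟩
    · rintro _ ⟨x, rfl⟩
      exact hp (mem_univ x)
    · rintro _ ⟨x, rfl⟩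
      exact (heq x).trans_le (hq x.2)
    · refine le_of_forall_pos_le_add fun η hη => abs_sub_le_iff.2 ⟨?_, ?_⟩
      · obtain ⟨x, hx, hle⟩ := H₁.exists_mem_boundary_sub_le H₂ p hη
        exact hle.trans (add_le_add_left ((le_abs_self _).trans (hq hx)) η)
      · obtain ⟨x, hx, hle⟩ := H₂.exists_mem_boundary_sub_le H₁ p hη
        refine hle.trans (add_le_add_left (le_trans ?_ (hq hx)) η)
        change φ₂ x - φ₁ x ≤ |φ₁ x - φ₂ x|
        rw [abs_sub_comm]
        exact le_abs_self _
  refine ⟨main, fun h φ₁ φ₂ H₁ H₂ => funext fun p => ?_⟩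
  obtain ⟨m, m', hm, ⟨⟨q, hq⟩, -⟩, hle⟩ := main h h φ₁ φ₂ H₁ H₂
  have h0 : |φ₁ p - φ₂ p| ≤ 0 := by
    refine (hm.2 ⟨p, rfl⟩).trans (hle.trans (le_of_eq ?_))
    rw [← hq]
    simp
  exact sub_eq_zero.1 (abs_nonpos_iff.1 h0)
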